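/- Let $(M^2,g)$ be an oriented Riemannian surface with a given spin structure and let $E\to M$ be an oriented Riemannian vector bundle of rank $2$ with a metric connection and a given spin structure. Let $\Sigma=\Sigma M\otimes\Sigma E$ be the twisted spinor bundle, with the connection $\nabla=\nabla^{\Sigma M}\otimes\mathrm{Id}+\mathrm{Id}\otimes\nabla^{\Sigma E}$ induced by the Levi-Civita connection of $M$ and the connection of $E$, and with the Clifford multiplication $X\cdot(\alpha\otimes\sigma)=(X\cdot_M\alpha)\otimes(\sigma^+-\sigma^-)$ for $X\in TM$ and $\nu\cdot(\alpha\otimes\sigma)=\alpha\otimes(\nu\cdot_E\sigma)$ for $\nu\in E$. Let $D\varphi=e_1\cdot\nabla_{e_1}\varphi+e_2\cdot\nabla_{e_2}\varphi$ be the Dirac operator, where $(e_1,e_2)$ is an orthonormal frame of $TM$. Write $\varphi=\varphi^++\varphi^-$ with $\varphi^+\in\Sigma^+=(\Sigma^+M\otimes\Sigma^+E)\oplus(\Sigma^-M\otimes\Sigma^-E)$ and $\varphi^-\in\Sigma^-=(\Sigma^+M\otimes\Sigma^-E)\oplus(\Sigma^-M\otimes\Sigma^+E)$. In a local spin frame a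 positive spinor $\psi\in\Sigma^+$ is represented by a quaternion $[\psi]\in\mathbb H$, and changes of spin frame multiply $[\psi]$ from the left by unit quaternions; put $\langle\langle\psi,\psi'\rangle\rangle=\overline{[\psi']}\,[\psi]\in\mathbb H$ for $\psi,\psi'\in\Sigma^+$, which does not depend on the frame. Let $\vec H$ be a section of $E$ and let $\varphi\in\Gamma(\Sigma)$ be a smooth solution of $D\varphi=\vec H\cdot\varphi$ with $|\varphi^+|=|\varphi^-|=1$. Then $$\xi(X)=\langle\langle X\cdot\varphi^-,\varphi^+\rangle\rangle,\qquad X\in TM,$$ defines a smooth $\mathbb H$-valued one-form $\xi\in\Omega^1(M,\mathbb H)$, and $\xi$ is closed: $d\xi=0$. -/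

import Mathlib

open Bundle Manifold Module
open scoped ContDiff Quaternion Kronecker

noncomputable section

namespace SpinSurface

/-! ### The model: spinors of `ℝ² ⊕ ℝ²` -/

/-- Clifford multiplication by the standard basis `e₁, e₂` of the Euclidean plane on its space of
spinors `Δ = Δ⁺ ⊕ Δ⁻ = ℂ ⊕ ℂ`. One has `eₐ² = -1`, `e₁ e₂ = - e₂ e₁`, and `Δ^±` is the eigenspace of
`i e₁ e₂` for the eigenvalue `±1`. -/
def gamma : Fin 2 → Matrix (Fin 2) (Fin 2) ℂ :=
  ![!![0, Complex.I; Complex.I, 0], !![0, 1; -1, 0]]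

/-- The conjugation `σ = σ⁺ + σ⁻ ↦ σ⁺ - σ⁻` of `Δ`. -/
def conjMat : Matrix (Fin 2) (Fin 2) ℂ := !![1, 0; 0, -1]

/-- The action on `Δ` of the element `a + b e₁ e₂` of the group `Spin(2)`, which is identified with
the unit circle by `a + b e₁ e₂ ↔ a + i b`. -/
def spinMat (z : ℂ) : Matrix (Fin 2) (Fin 2) ℂ :=
  z.re • (1 : Matrix (Fin 2) (Fin 2) ℂ) + z.im • (gamma 0 * gamma 1)

/-- The Hermitian space `Δ ⊗ Δ`. The coordinate with index `(a, b)` belongs to the summand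
`Δ^± ⊗ Δ^±`, where `0` stands for `+` and `1` stands for `-`. -/
abbrev Spinor : Type := EuclideanSpace ℂ (Fin 2 × Fin 2)

/-- The operator `A ⊗ B` on `Δ ⊗ Δ`. -/
def tensorOp (A B : Matrix (Fin 2) (Fin 2) ℂ) : Spinor →L[ℝ] Spinor :=
  (Matrix.toEuclideanCLM (𝕜 := ℂ) (A ⊗ₖ B)).restrictScalars ℝ

/-- Clifford multiplication of `Δ ⊗ Δ` by the vector `c₀ e₁ + c₁ e₂` of the first plane, where
`e · (α ⊗ σ) = (e · α) ⊗ (σ⁺ - σ⁻)`. -/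
def cliffordLeft (c : Fin 2 → ℝ) (ψ : Spinor) : Spinor := ∑ a, c a • tensorOp (gamma a) conjMat ψ

/-- Clifford multiplication of `Δ ⊗ Δ` by the vector `c₀ e₃ + c₁ e₄` of the second plane, where
`e · (α ⊗ σ) = α ⊗ (e · σ)`. -/
def cliffordRight (c : Fin 2 → ℝ) (ψ : Spinor) : Spinor := ∑ a, c a • tensorOp 1 (gamma a) ψ

/-- The component `φ⁺` in `(Δ⁺ ⊗ Δ⁺) ⊕ (Δ⁻ ⊗ Δ⁻)`. -/
def plusPart (ψ : Spinor) : Spinor := WithLp.toLp 2 fun p => if p.1 = p.2 then ψ p else 0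

/-- The component `φ⁻` in `(Δ⁺ ⊗ Δ⁻) ⊕ (Δ⁻ ⊗ Δ⁺)`. -/
def minusPart (ψ : Spinor) : Spinor := WithLp.toLp 2 fun p => if p.1 = p.2 then 0 else ψ p

/-- The quaternion `[φ⁺] = φ⁺⁺ + J φ⁻⁻` of a positive spinor. Multiplication of quaternions from the
right by `I` is multiplication of spinors by `i`, and even elements of the Clifford algebra act
as multiplications of quaternions from the left. -/
def quat : Spinor →ₗ[ℝ] ℍ[ℝ] where
  toFun ψ := ⟨(ψ (0, 0)).re, (ψ (0, 0)).im, (ψ (1, 1)).re, -(ψ (1, 1)).im⟩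
  map_add' ψ ψ' := by
    refine QuaternionAlgebra.ext ?_ ?_ ?_ ?_
    · exact rfl
    · exact rfl
    · exact rfl
    · exact neg_add _ _
  map_smul' r ψ := by
    refine QuaternionAlgebra.ext ?_ ?_ ?_ ?_
    · exact Complex.smul_re r _
    · exact Complex.smul_im r _
    · exact Complex.smul_re r _
    · exact (congrArg _ (Complex.smul_im r _)).trans (mul_neg _ _).symm

/-- The pairing `⟨⟨φ⁺, ψ⁺⟩⟩ = conj [ψ⁺] * [φ⁺]` of positive spinors. -/
def pairing (φ ψ : Spinor) : ℍ[ℝ] := star (quat ψ) * quat φ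

theorem pairing_cliffordLeft_add (c d : Fin 2 → ℝ) (φ ψ : Spinor) :
    pairing (cliffordLeft (fun a => c a + d a) φ) ψ =
      pairing (cliffordLeft c φ) ψ + pairing (cliffordLeft d φ) ψ := by
  simp only [pairing, cliffordLeft, add_smul, Finset.sum_add_distrib, map_add, mul_add]

theorem pairing_cliffordLeft_smul (r : ℝ) (c : Fin 2 → ℝ) (φ ψ : Spinor) :
    pairing (cliffordLeft (fun a => r * c a) φ) ψ = r • pairing (cliffordLeft c φ) ψ := by
  simp only [pairing, cliffordLeft, mul_smul, ← Finset.smul_sum, map_smul, mul_smul_comm]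

theorem tensorOp_mul (A B A' B' : Matrix (Fin 2) (Fin 2) ℂ) (v : Spinor) :
    tensorOp A B (tensorOp A' B' v) = tensorOp (A * A') (B * B') v := by
  simp [tensorOp, Matrix.mul_kronecker_mul, map_mul]

theorem gamma_zero_mul_one : gamma 0 * gamma 1 = !![-Complex.I, 0; 0, Complex.I] := by
  ext i j; fin_cases i <;> fin_cases j <;> simp [gamma]

theorem spinMat_eq (z : ℂ) : spinMat z = !![star z, 0; 0, z] := by
  rw [spinMat, gamma_zero_mul_one]
  ext i j; fin_cases i <;> fin_cases j <;> apply Complex.ext <;> simp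

theorem spinMat_mul (z w : ℂ) : spinMat z * spinMat w = spinMat (z * w) := by
  simp [spinMat_eq]

theorem spinMat_one : spinMat 1 = 1 := by
  simp [spinMat]

theorem tensorOp_one (v : Spinor) : tensorOp 1 1 v = v := by
  simp [tensorOp]

theorem tensorOp_spinMat (z w : ℂ) : tensorOp (spinMat z) (spinMat w) =
    (z.re * w.re) • tensorOp 1 1 + (z.re * w.im) • tensorOp 1 (gamma 0 * gamma 1)
    + (z.im * w.re) • tensorOp (gamma 0 * gamma 1) 1
    + (z.im * w.im) • tensorOp (gamma 0 * gamma 1) (gamma 0 * gamma 1) := by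
  ext v p
  simp [tensorOp, spinMat, Matrix.add_kronecker, Matrix.kronecker_add, Matrix.smul_kronecker,
    Matrix.kronecker_smul, Matrix.smul_mulVec, mul_smul]
  ring

theorem contDiff_tensorOp_spinMat :
    ContDiff ℝ ∞ fun p : ℂ × ℂ => tensorOp (spinMat p.1) (spinMat p.2) := by
  simp only [tensorOp_spinMat]
  have h1 : ContDiff ℝ ∞ fun p : ℂ × ℂ => p.1.re := Complex.reCLM.contDiff.comp contDiff_fst
  have h2 : ContDiff ℝ ∞ fun p : ℂ × ℂ => p.1.im := Complex.imCLM.contDiff.comp contDiff_fst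
  have h3 : ContDiff ℝ ∞ fun p : ℂ × ℂ => p.2.re := Complex.reCLM.contDiff.comp contDiff_snd
  have h4 : ContDiff ℝ ∞ fun p : ℂ × ℂ => p.2.im := Complex.imCLM.contDiff.comp contDiff_snd
  fun_prop

/-! ### Orientations and spin structures of Riemannian bundles of rank two over a surface -/

section Bundles

variable {M : Type*} [TopologicalSpace M] [ChartedSpace (EuclideanSpace ℝ (Fin 2)) M]

section RankTwo

variable (V : M → Type*) [TopologicalSpace (TotalSpace (EuclideanSpace ℝ (Fin 2)) V)]
  [∀ x, NormedAddCommGroup (V x)] [∀ x, InnerProductSpace ℝ (V x)]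
  [FiberBundle (EuclideanSpace ℝ (Fin 2)) V]

/-- An orientation of a bundle of rank two: an orientation of every fibre such that near every point
there is a smooth frame which is positively oriented. -/
structure BundleOrientation where
  at' : ∀ x, Orientation ℝ (V x) (Fin 2)
  locally_const : ∀ x, ∃ (U : Set M) (s : Fin 2 → (y : M) → V y)
    (hs : IsLocalFrameOn (𝓡 2) (EuclideanSpace ℝ (Fin 2)) ∞ s U),
    IsOpen U ∧ x ∈ U ∧ ∀ y (hy : y ∈ U), (hs.toBasisAt hy).orientation = at' y

variable {V}

/-- A spin structure on an oriented Riemannian bundle of rank two: positively oriented orthonormal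
smooth frames on the sets of an open cover, and a cocycle of lifts of the transition functions, from
`SO(2)` to `Spin(2)`. Here `Spin(2)` is the unit circle, with the covering `z ↦ (rotation by z²)` of
`SO(2)`, and `lift i j x` covers the transition from the frame `i` to the frame `j` at `x`. -/
structure SpinStructure (o : BundleOrientation V) (ι : Type*) where
  dom : ι → Set M
  isOpen_dom : ∀ i, IsOpen (dom i)
  covers : ∀ x, ∃ i, x ∈ dom i
  frame : ι → Fin 2 → (x : M) → V x
  isFrame : ∀ i, IsLocalFrameOn (𝓡 2) (EuclideanSpace ℝ (Fin 2)) ∞ (frame i) (dom i)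
  orthonormal : ∀ i, ∀ x ∈ dom i, Orthonormal ℝ fun a => frame i a x
  positive : ∀ i x (hx : x ∈ dom i), ((isFrame i).toBasisAt hx).orientation = o.at' x
  lift : ι → ι → M → Circle
  smooth_lift : ∀ i j,
    ContMDiffOn (𝓡 2) 𝓘(ℝ, ℂ) ∞ (fun x => (lift i j x : ℂ)) (dom i ∩ dom j)
  lift_zero : ∀ i j, ∀ x ∈ dom i ∩ dom j, frame j 0 x =
    ((lift i j x : ℂ) ^ 2).re • frame i 0 x + ((lift i j x : ℂ) ^ 2).im • frame i 1 x
  lift_one : ∀ i j, ∀ x ∈ dom i ∩ dom j, frame j 1 x =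
    -((lift i j x : ℂ) ^ 2).im • frame i 0 x + ((lift i j x : ℂ) ^ 2).re • frame i 1 x
  cocycle : ∀ i j k, ∀ x ∈ dom i ∩ dom j ∩ dom k, lift i j x * lift j k x = lift i k x

theorem SpinStructure.lift_self {o : BundleOrientation V} {ι : Type*} (s : SpinStructure o ι)
    (i : ι) (x : M) (hx : x ∈ s.dom i) : s.lift i i x = 1 := by
  simpa using s.cocycle i i i x ⟨⟨hx, hx⟩, hx⟩

end RankTwo

/-! ### The twisted spinor bundle -/

section Twisted

variable {V : M → Type*} [TopologicalSpace (TotalSpace (EuclideanSpace ℝ (Fin 2)) V)]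
  [∀ x, NormedAddCommGroup (V x)] [∀ x, InnerProductSpace ℝ (V x)]
  [FiberBundle (EuclideanSpace ℝ (Fin 2)) V]
  {E : M → Type*} [TopologicalSpace (TotalSpace (EuclideanSpace ℝ (Fin 2)) E)]
  [∀ x, NormedAddCommGroup (E x)] [∀ x, InnerProductSpace ℝ (E x)]
  [FiberBundle (EuclideanSpace ℝ (Fin 2)) E]
  {oV : BundleOrientation V} {oE : BundleOrientation E}
  {ι κ : Type*} (sV : SpinStructure oV ι) (sE : SpinStructure oE κ)

/-- The transition function of `Σ`, from the coordinates in the pair of frames `i` to those in the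
pair of frames `j`. -/
def transition (i j : ι × κ) (x : M) : Spinor →L[ℝ] Spinor :=
  tensorOp (spinMat (sV.lift j.1 i.1 x)) (spinMat (sE.lift j.2 i.2 x))

theorem transition_self (i : ι × κ) (x : M) (hx : x ∈ sV.dom i.1 ∩ sE.dom i.2) (v : Spinor) :
    transition sV sE i i x v = v := by
  rw [transition, sV.lift_self _ _ hx.1, sE.lift_self _ _ hx.2, Circle.coe_one, spinMat_one,
    tensorOp_one]

theorem contMDiffOn_transition (i j : ι × κ) :
    ContMDiffOn (𝓡 2) 𝓘(ℝ, Spinor →L[ℝ] Spinor) ∞ (transition sV sE i j)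
      ((sV.dom i.1 ∩ sE.dom i.2) ∩ (sV.dom j.1 ∩ sE.dom j.2)) := by
  have h1 := (sV.smooth_lift j.1 i.1).mono
    (show (sV.dom i.1 ∩ sE.dom i.2) ∩ (sV.dom j.1 ∩ sE.dom j.2) ⊆ _ from
      fun x hx => ⟨hx.2.1, hx.1.1⟩)
  have h2 := (sE.smooth_lift j.2 i.2).mono
    (show (sV.dom i.1 ∩ sE.dom i.2) ∩ (sV.dom j.1 ∩ sE.dom j.2) ⊆ _ from
      fun x hx => ⟨hx.2.2, hx.1.2⟩)
  exact ContMDiff.comp_contMDiffOn (I' := 𝓘(ℝ, ℂ × ℂ))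
    (g := fun p : ℂ × ℂ => tensorOp (spinMat p.1) (spinMat p.2))
    (f := fun x => ((sV.lift j.1 i.1 x : ℂ), (sE.lift j.2 i.2 x : ℂ)))
    contDiff_tensorOp_spinMat.contMDiff (h1.prodMk_space h2)

theorem transition_comp (i j k : ι × κ) (x : M)
    (hx : x ∈ (sV.dom i.1 ∩ sE.dom i.2) ∩ (sV.dom j.1 ∩ sE.dom j.2) ∩ (sV.dom k.1 ∩ sE.dom k.2))
    (v : Spinor) :
    transition sV sE j k x (transition sV sE i j x v) = transition sV sE i k x v := by
  simp only [transition]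
  rw [tensorOp_mul, spinMat_mul, spinMat_mul, ← Circle.coe_mul, ← Circle.coe_mul,
    sV.cocycle k.1 j.1 i.1 x ⟨⟨hx.2.1, hx.1.2.1⟩, hx.1.1.1⟩,
    sE.cocycle k.2 j.2 i.2 x ⟨⟨hx.2.2, hx.1.2.2⟩, hx.1.1.2⟩]

/-- The bundle `Σ = ΣV ⊗ ΣE` associated to the spin structures of `V` and `E` (below, `V = TM`) and
to the spinor representations: it is glued from the products with `Δ ⊗ Δ` of the common domains of
the pairs of frames. The fibre over `x` is identified with `Δ ⊗ Δ` by a chosen pair of frames around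
`x`. -/
def spinorBundle : VectorBundleCore ℝ M Spinor (ι × κ) where
  baseSet i := sV.dom i.1 ∩ sE.dom i.2
  isOpen_baseSet i := (sV.isOpen_dom i.1).inter (sE.isOpen_dom i.2)
  indexAt x := (Classical.choose (sV.covers x), Classical.choose (sE.covers x))
  mem_baseSet_at x := ⟨Classical.choose_spec (sV.covers x), Classical.choose_spec (sE.covers x)⟩
  coordChange := transition sV sE
  coordChange_self := transition_self sV sE
  continuousOn_coordChange i j := (contMDiffOn_transition sV sE i j).continuousOn
  coordChange_comp := transition_comp sV sE

instance : (spinorBundle sV sE).IsContMDiff (𝓡 2) ∞ where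
  contMDiffOn_coordChange := contMDiffOn_transition sV sE

/-- The space `Γ(Σ)` of smooth sections. -/
abbrev SpinorField : Type _ :=
  ContMDiffSection (𝓡 2) Spinor ∞ (spinorBundle sV sE).Fiber

/-- The orthonormal frame `e₁, e₂` of `V` around `x` which is used to identify `Σ_x` with
`Δ ⊗ Δ`. -/
def firstFrame (x : M) : Fin 2 → (y : M) → V y :=
  sV.frame ((spinorBundle sV sE).indexAt x).1

/-- The orthonormal frame `e₃, e₄` of `E` around `x` which is used to identify `Σ_x` with
`Δ ⊗ Δ`. -/
def secondFrame (x : M) : Fin 2 → (y : M) → E y :=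
  sE.frame ((spinorBundle sV sE).indexAt x).2

/-- The component `φ⁺ ∈ Σ_x⁺` of `φ ∈ Σ_x`. -/
def fiberPlus (x : M) (ψ : (spinorBundle sV sE).Fiber x) : (spinorBundle sV sE).Fiber x :=
  plusPart ψ

/-- The component `φ⁻ ∈ Σ_x⁻` of `φ ∈ Σ_x`. -/
def fiberMinus (x : M) (ψ : (spinorBundle sV sE).Fiber x) : (spinorBundle sV sE).Fiber x :=
  minusPart ψ

/-- The Hermitian norm of `Σ_x`. -/
def fiberNorm (x : M) (ψ : (spinorBundle sV sE).Fiber x) : ℝ :=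
  ‖(show Spinor from ψ)‖

/-- The pairing `⟨⟨·, ·⟩⟩` of `Σ_x⁺`. It does not depend on the frames that identify `Σ_x` with `Δ ⊗ Δ`,
since a change of frames acts on `[φ⁺]` as the multiplication by a unit quaternion from the left. -/
def fiberPairing (x : M) (φ ψ : (spinorBundle sV sE).Fiber x) : ℍ[ℝ] :=
  pairing φ ψ

/-- Clifford multiplication by vectors of `V`. -/
def cliffordFirst (x : M) (X : V x) (ψ : (spinorBundle sV sE).Fiber x) :
    (spinorBundle sV sE).Fiber x :=
  cliffordLeft (fun a => inner ℝ (firstFrame sV sE x a x) X) ψ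

/-- Clifford multiplication by vectors of `E`. -/
def cliffordSecond (x : M) (ν : E x) (ψ : (spinorBundle sV sE).Fiber x) :
    (spinorBundle sV sE).Fiber x :=
  cliffordRight (fun a => inner ℝ (secondFrame sV sE x a x) ν) ψ

/-- The spinorial connection `∇ = ∇^{ΣV} ⊗ Id + Id ⊗ ∇^{ΣE}` induced by connections of `V` and `E`.
In the chosen frames around `x`,
`∇_X φ = X(φ) + ½ ⟨∇_X e₁, e₂⟩ e₁ · e₂ · φ + ½ ⟨∇_X e₃, e₄⟩ e₃ · e₄ · φ`. -/
def spinorConnection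
    (covV : CovariantDerivative (𝓡 2) (EuclideanSpace ℝ (Fin 2)) V)
    (covE : CovariantDerivative (𝓡 2) (EuclideanSpace ℝ (Fin 2)) E)
    (φ : SpinorField sV sE) (x : M) (X : TangentSpace (𝓡 2) x) :
    (spinorBundle sV sE).Fiber x :=
  (mvfderiv (𝓡 2) (fun y : M => (spinorBundle sV sE).coordChange
      ((spinorBundle sV sE).indexAt y) ((spinorBundle sV sE).indexAt x) y (φ y)) x X : Spinor)
  + ((1 / 2 : ℝ) * inner ℝ (covV (firstFrame sV sE x 0) x X) (firstFrame sV sE x 1 x)) •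
      tensorOp (gamma 0 * gamma 1) 1 (φ x)
  + ((1 / 2 : ℝ) * inner ℝ (covE (secondFrame sV sE x 0) x X) (secondFrame sV sE x 1 x)) •
      tensorOp 1 (gamma 0 * gamma 1) (φ x)

end Twisted

/-! ### The Dirac operator and the quaternionic one-form -/

variable [IsManifold (𝓡 2) ∞ M]
  [RiemannianBundle (fun x : M => TangentSpace (𝓡 2) x)]
  {E : M → Type*} [TopologicalSpace (TotalSpace (EuclideanSpace ℝ (Fin 2)) E)]
  [∀ x, NormedAddCommGroup (E x)] [∀ x, InnerProductSpace ℝ (E x)]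
  [FiberBundle (EuclideanSpace ℝ (Fin 2)) E]
  {oM : BundleOrientation fun x : M => TangentSpace (𝓡 2) x} {oE : BundleOrientation E}
  {ι κ : Type*} (sM : SpinStructure oM ι) (sE : SpinStructure oE κ)

/-- The Dirac operator `D φ = e₁ · ∇_{e₁} φ + e₂ · ∇_{e₂} φ`. -/
def dirac
    (covM : CovariantDerivative (𝓡 2) (EuclideanSpace ℝ (Fin 2))
      (fun x : M => TangentSpace (𝓡 2) x))
    (covE : CovariantDerivative (𝓡 2) (EuclideanSpace ℝ (Fin 2)) E)
    (φ : SpinorField sM sE) (x : M) : (spinorBundle sM sE).Fiber x :=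
  ∑ a, cliffordFirst sM sE x (firstFrame sM sE x a x)
    (spinorConnection sM sE covM covE φ x (firstFrame sM sE x a x))

/-- The `ℍ`-valued form `ξ(X) = ⟨⟨X · φ⁻, φ⁺⟩⟩`, where `X · φ⁻` and `φ⁺` belong to `Σ⁺`. -/
def xi (φ : SpinorField sM sE) (x : M) : TangentSpace (𝓡 2) x →L[ℝ] ℍ[ℝ] :=
  haveI : FiniteDimensional ℝ (TangentSpace (𝓡 2) x) :=
    inferInstanceAs (FiniteDimensional ℝ (EuclideanSpace ℝ (Fin 2)))
  LinearMap.toContinuousLinearMap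
    { toFun := fun X => fiberPairing sM sE x
        (cliffordFirst sM sE x X (fiberMinus sM sE x (φ x))) (fiberPlus sM sE x (φ x))
      map_add' := by
        intro X Y
        simp only [fiberPairing, cliffordFirst, inner_add_right]
        exact pairing_cliffordLeft_add _ _ _ _
      map_smul' := by
        intro r X
        simp only [fiberPairing, cliffordFirst, inner_smul_right]
        exact pairing_cliffordLeft_smul _ _ _ _ }

end Bundles

/-! ### Differential forms of degree one -/

section Forms

variable {M : Type*} [TopologicalSpace M] [ChartedSpace (EuclideanSpace ℝ (Fin 2)) M]
  [IsManifold (𝓡 2) ∞ M] {W : Type*} [NormedAddCommGroup W] [NormedSpace ℝ W]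

/-- `θ` is a smooth one-form with values in `W`. -/
def IsSmoothOneForm (θ : (x : M) → TangentSpace (𝓡 2) x →L[ℝ] W) : Prop :=
  ContMDiff (𝓡 2) ((𝓡 2).prod 𝓘(ℝ, EuclideanSpace ℝ (Fin 2) →L[ℝ] W)) ∞
    (fun x => TotalSpace.mk' (EuclideanSpace ℝ (Fin 2) →L[ℝ] W)
      (E := fun x : M => TangentSpace (𝓡 2) x →L[ℝ] Bundle.Trivial M W x) x (θ x))

/-- The exterior derivative `dθ(X, Y) = X(θ(Y)) - Y(θ(X)) - θ([X, Y])`. -/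
def extDerivOneForm (θ : (x : M) → TangentSpace (𝓡 2) x →L[ℝ] W)
    (X Y : (x : M) → TangentSpace (𝓡 2) x) (x : M) : W :=
  mvfderiv (𝓡 2) (fun y => θ y (Y y)) x (X x) - mvfderiv (𝓡 2) (fun y => θ y (X y)) x (Y x)
    - θ x (VectorField.mlieBracket (𝓡 2) X Y x)

/-- `dθ = 0`: the exterior derivative vanishes at every point `x`, on all vector fields that are
smooth near `x`. -/
def IsClosedOneForm (θ : (x : M) → TangentSpace (𝓡 2) x →L[ℝ] W) : Prop :=
  ∀ (x : M) (X Y : (x : M) → TangentSpace (𝓡 2) x),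
    ContMDiffAt (𝓡 2) ((𝓡 2).prod (𝓡 2)) ∞ (fun y => (X y : TangentBundle (𝓡 2) M)) x →
    ContMDiffAt (𝓡 2) ((𝓡 2).prod (𝓡 2)) ∞ (fun y => (Y y : TangentBundle (𝓡 2) M)) x →
    extDerivOneForm θ X Y x = 0

end Forms

set_option synthInstance.maxHeartbeats 400000 in
/-- `cov` is the Levi-Civita connection: it is torsion-free and compatible with the metric. -/
def IsLeviCivita {M : Type*} [TopologicalSpace M] [ChartedSpace (EuclideanSpace ℝ (Fin 2)) M]
    [IsManifold (𝓡 2) ∞ M] [RiemannianBundle (fun x : M => TangentSpace (𝓡 2) x)]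
    [IsContMDiffRiemannianBundle (𝓡 2) ∞ (EuclideanSpace ℝ (Fin 2))
      (fun x : M => TangentSpace (𝓡 2) x)]
    (cov : CovariantDerivative (𝓡 2) (EuclideanSpace ℝ (Fin 2))
      (fun x : M => TangentSpace (𝓡 2) x)) : Prop :=
  cov.torsion = 0 ∧ cov.IsMetricCompatible

end SpinSurface

end

noncomputable section

namespace SpinSurface

/-! Fix a point x and the pair of frames chosen there, and let θ_a = ⟨e_a, ·⟩ and f_a = ⟨⟨e_a · φ⁻,
φ⁺⟩⟩, everything read in these frames. Spin invariance of the pairing gives ξ = θ₁ f₁ + θ₂ f₂ on a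
whole neighbourhood of x (`xi_eq`), although `xi` is defined through a frame choice that may jump
from point to point. Smoothness follows at once.

For closedness let ω(X) = ⟨∇_X e₁, e₂⟩. A Levi-Civita connection gives dθ₁ = ω ∧ θ₂ and dθ₂ = -ω ∧
θ₁ at x (`extDeriv_coframe`). The Leibniz rule gives df₁ = C₁ + ω f₂ and df₂ = C₂ - ω f₁ at x, where
C_a(X) = ⟨⟨e_a · ∇_X φ⁻, φ⁺⟩⟩ + ⟨⟨e_a · φ⁻, ∇_X φ⁺⟩⟩ (`mvfderiv_xiCoeff`). In dξ the terms with ω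
cancel, and (C₂(e₁) - C₁(e₂)) θ₁ ∧ θ₂ is left.

This coefficient vanishes by the Dirac equation (`pairingForm_dirac`). Since e₂ · ∇_{e₁} - e₁ ·
∇_{e₂} = e₁ · e₂ · D, it is a sum of two terms built from N = e₁ · e₂ · H. Extend the pairing to Σ⁻
by ⟨⟨e · a, e · b⟩⟩ with any unit vector e; then a vector moves across it at the cost of a sign.
Reversing the order of the factors changes the sign of N once more, so the two terms are opposite.
-/

/-! ### Algebra of the pairing on Δ ⊗ Δ, in coordinates -/

theorem tensorOp_apply (A B : Matrix (Fin 2) (Fin 2) ℂ) (ψ : Spinor) (p : Fin 2 × Fin 2) :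
    tensorOp A B ψ p = ∑ c, ∑ d, A p.1 c * B p.2 d * ψ (c, d) := by
  change (A ⊗ₖ B).mulVec ψ p = _
  simp [Matrix.mulVec, dotProduct, Fintype.sum_prod_type]

theorem cliffordLeft_apply (c : Fin 2 → ℝ) (ψ : Spinor) (p : Fin 2 × Fin 2) :
    cliffordLeft c ψ p = (if p.2 = 0 then 1 else -1) *
      (if p.1 = 0 then (c 0 * Complex.I + c 1) * ψ (1, p.2)
        else (c 0 * Complex.I - c 1) * ψ (0, p.2)) := by
  obtain ⟨a, b⟩ := p
  fin_cases a <;> fin_cases b <;>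
    simp [cliffordLeft, tensorOp_apply, gamma, conjMat] <;> ring

theorem cliffordRight_apply (c : Fin 2 → ℝ) (ψ : Spinor) (p : Fin 2 × Fin 2) :
    cliffordRight c ψ p = ∑ a, (c a : ℂ) * tensorOp 1 (gamma a) ψ p := by
  simp [cliffordRight]

theorem plusPart_apply (ψ : Spinor) (p : Fin 2 × Fin 2) :
    plusPart ψ p = if p.1 = p.2 then ψ p else 0 := rfl

theorem minusPart_apply (ψ : Spinor) (p : Fin 2 × Fin 2) :
    minusPart ψ p = if p.1 = p.2 then 0 else ψ p := rfl

theorem quat_re (ψ : Spinor) : (quat ψ).re = (ψ (0, 0)).re := rfl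

theorem quat_imI (ψ : Spinor) : (quat ψ).imI = (ψ (0, 0)).im := rfl

theorem quat_imJ (ψ : Spinor) : (quat ψ).imJ = (ψ (1, 1)).re := rfl

theorem quat_imK (ψ : Spinor) : (quat ψ).imK = -(ψ (1, 1)).im := rfl

/-- The bilinear form in `φ` and `ψ` given by the pairing of `c · φ⁻` with `ψ⁺`. -/
def pairingForm (c : Fin 2 → ℝ) (φ ψ : Spinor) : ℍ[ℝ] :=
  pairing (cliffordLeft c (minusPart φ)) (plusPart ψ)

theorem pairingForm_re (c : Fin 2 → ℝ) (φ ψ : Spinor) : (pairingForm c φ ψ).re =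
    (ψ (0, 0)).re * (-c 0 * (φ (1, 0)).im + c 1 * (φ (1, 0)).re)
    + (ψ (0, 0)).im * (c 0 * (φ (1, 0)).re + c 1 * (φ (1, 0)).im)
    + (ψ (1, 1)).re * (c 0 * (φ (0, 1)).im + c 1 * (φ (0, 1)).re)
    - (ψ (1, 1)).im * (c 0 * (φ (0, 1)).re - c 1 * (φ (0, 1)).im) := by
  simp [pairingForm, pairing, Quaternion.re_mul, quat_re, quat_imI, quat_imJ, quat_imK,
    plusPart_apply, minusPart_apply, cliffordLeft_apply]
  ring

theorem pairingForm_imI (c : Fin 2 → ℝ) (φ ψ : Spinor) : (pairingForm c φ ψ).imI =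
    (ψ (0, 0)).re * (c 0 * (φ (1, 0)).re + c 1 * (φ (1, 0)).im)
    - (ψ (0, 0)).im * (-c 0 * (φ (1, 0)).im + c 1 * (φ (1, 0)).re)
    - (ψ (1, 1)).re * (c 0 * (φ (0, 1)).re - c 1 * (φ (0, 1)).im)
    - (ψ (1, 1)).im * (c 0 * (φ (0, 1)).im + c 1 * (φ (0, 1)).re) := by
  simp [pairingForm, pairing, Quaternion.imI_mul, quat_re, quat_imI, quat_imJ, quat_imK,
    plusPart_apply, minusPart_apply, cliffordLeft_apply]
  ring

theorem pairingForm_imJ (c : Fin 2 → ℝ) (φ ψ : Spinor) : (pairingForm c φ ψ).imJ =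
    (ψ (0, 0)).re * (c 0 * (φ (0, 1)).im + c 1 * (φ (0, 1)).re)
    + (ψ (0, 0)).im * (c 0 * (φ (0, 1)).re - c 1 * (φ (0, 1)).im)
    - (ψ (1, 1)).re * (-c 0 * (φ (1, 0)).im + c 1 * (φ (1, 0)).re)
    + (ψ (1, 1)).im * (c 0 * (φ (1, 0)).re + c 1 * (φ (1, 0)).im) := by
  simp [pairingForm, pairing, Quaternion.imJ_mul, quat_re, quat_imI, quat_imJ, quat_imK,
    plusPart_apply, minusPart_apply, cliffordLeft_apply]
  ring

theorem pairingForm_imK (c : Fin 2 → ℝ) (φ ψ : Spinor) : (pairingForm c φ ψ).imK =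
    (ψ (0, 0)).re * (c 0 * (φ (0, 1)).re - c 1 * (φ (0, 1)).im)
    - (ψ (0, 0)).im * (c 0 * (φ (0, 1)).im + c 1 * (φ (0, 1)).re)
    + (ψ (1, 1)).re * (c 0 * (φ (1, 0)).re + c 1 * (φ (1, 0)).im)
    + (ψ (1, 1)).im * (-c 0 * (φ (1, 0)).im + c 1 * (φ (1, 0)).re) := by
  simp [pairingForm, pairing, Quaternion.imK_mul, quat_re, quat_imI, quat_imJ, quat_imK,
    plusPart_apply, minusPart_apply, cliffordLeft_apply]
  ring

theorem pairingForm_eq_add (c : Fin 2 → ℝ) (φ ψ : Spinor) :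
    pairingForm c φ ψ =
      c 0 • pairingForm (Pi.single 0 1) φ ψ + c 1 • pairingForm (Pi.single 1 1) φ ψ := by
  ext <;> simp [pairingForm_re, pairingForm_imI, pairingForm_imJ, pairingForm_imK] <;> ring

theorem pairingForm_add_left (c : Fin 2 → ℝ) (φ φ' ψ : Spinor) :
    pairingForm c (φ + φ') ψ = pairingForm c φ ψ + pairingForm c φ' ψ := by
  ext <;> simp [pairingForm_re, pairingForm_imI, pairingForm_imJ, pairingForm_imK] <;> ring

theorem pairingForm_add_right (c : Fin 2 → ℝ) (φ ψ ψ' : Spinor) :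
    pairingForm c φ (ψ + ψ') = pairingForm c φ ψ + pairingForm c φ ψ' := by
  ext <;> simp [pairingForm_re, pairingForm_imI, pairingForm_imJ, pairingForm_imK] <;> ring

theorem pairingForm_smul_left (c : Fin 2 → ℝ) (r : ℝ) (φ ψ : Spinor) :
    pairingForm c (r • φ) ψ = r • pairingForm c φ ψ := by
  ext <;> simp [pairingForm_re, pairingForm_imI, pairingForm_imJ, pairingForm_imK] <;> ring

theorem pairingForm_smul_right (c : Fin 2 → ℝ) (r : ℝ) (φ ψ : Spinor) :
    pairingForm c φ (r • ψ) = r • pairingForm c φ ψ := by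
  ext <;> simp [pairingForm_re, pairingForm_imI, pairingForm_imJ, pairingForm_imK] <;> ring

/-- The pairing of `c · φ⁻` with `ψ⁺` as a continuous bilinear map. -/
def pairingCLM (c : Fin 2 → ℝ) : Spinor →L[ℝ] Spinor →L[ℝ] ℍ[ℝ] :=
  (LinearMap.mk₂ ℝ (pairingForm c) (pairingForm_add_left c) (pairingForm_smul_left c)
    (pairingForm_add_right c) (pairingForm_smul_right c)).toContinuousBilinearMap

theorem gamma_mul_apply (ψ : Spinor) (p : Fin 2 × Fin 2) :
    tensorOp (gamma 0 * gamma 1) 1 ψ p = (if p.1 = 0 then -Complex.I else Complex.I) * ψ p := by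
  obtain ⟨a, b⟩ := p
  rw [gamma_zero_mul_one, tensorOp_apply]
  fin_cases a <;> fin_cases b <;> simp [Matrix.one_apply]

theorem one_gamma_mul_apply (ψ : Spinor) (p : Fin 2 × Fin 2) :
    tensorOp 1 (gamma 0 * gamma 1) ψ p = (if p.2 = 0 then -Complex.I else Complex.I) * ψ p := by
  obtain ⟨a, b⟩ := p
  rw [gamma_zero_mul_one, tensorOp_apply]
  fin_cases a <;> fin_cases b <;> simp [Matrix.one_apply]

/-- The bivector e₁e₂ acts on [φ⁺] as left multiplication by an imaginary quaternion, hence is skew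
for the pairing, and it anticommutes with vectors of the first plane. The two terms therefore add up
to twice the pairing with c · e₁e₂, where e₁ · e₁e₂ = -e₂ and e₂ · e₁e₂ = e₁. -/
theorem pairingForm_gamma_mul (c : Fin 2 → ℝ) (φ : Spinor) :
    pairingForm c (tensorOp (gamma 0 * gamma 1) 1 φ) φ +
      pairingForm c φ (tensorOp (gamma 0 * gamma 1) 1 φ) =
    (2 : ℝ) • pairingForm ![c 1, -c 0] φ φ := by
  ext <;> simp [pairingForm_re, pairingForm_imI, pairingForm_imJ, pairingForm_imK,
    gamma_mul_apply] <;> ring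

/-- The bivector e₃e₄ is skew as well but commutes with vectors of the first plane, so the two terms
cancel. This is why the connection of `E` leaves no trace in dξ. -/
theorem pairingForm_one_gamma_mul (c : Fin 2 → ℝ) (φ : Spinor) :
    pairingForm c (tensorOp 1 (gamma 0 * gamma 1) φ) φ +
      pairingForm c φ (tensorOp 1 (gamma 0 * gamma 1) φ) = 0 := by
  ext <;> simp [pairingForm_re, pairingForm_imI, pairingForm_imJ, pairingForm_imK,
    one_gamma_mul_apply] <;> ring

/-- With `ψ a` in the role of ∇_{e_a} φ, the hypothesis is the Dirac equation at one point and the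
conclusion is the symmetry C₂(e₁) = C₁(e₂). -/
theorem pairingForm_dirac (ψ : Fin 2 → Spinor) (φ : Spinor) (h : Fin 2 → ℝ)
    (hψ : cliffordLeft (Pi.single 0 1) (ψ 0) + cliffordLeft (Pi.single 1 1) (ψ 1) =
      cliffordRight h φ) :
    pairingForm (Pi.single 1 1) (ψ 0) φ + pairingForm (Pi.single 1 1) φ (ψ 0) =
      pairingForm (Pi.single 0 1) (ψ 1) φ + pairingForm (Pi.single 0 1) φ (ψ 1) := by
  have key (p : Fin 2 × Fin 2) := congrArg (fun v : Spinor => v p) hψ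
  have h00 := key (0, 0)
  have h01 := key (0, 1)
  have h10 := key (1, 0)
  have h11 := key (1, 1)
  simp [cliffordLeft_apply, cliffordRight_apply, tensorOp_apply, gamma,
    Complex.ext_iff] at h00 h01 h10 h11
  ext <;> simp [pairingForm_re, pairingForm_imI, pairingForm_imJ, pairingForm_imK]
  -- The equations at (0, 0) and (1, 1) form the Σ⁺ part Dφ⁻ = H · φ⁻ and are multiplied by
  -- coordinates of φ⁺; the other two form the Σ⁻ part and are multiplied by coordinates of φ⁻. In
  -- each component of the quaternion the terms with `h` cancel between the two groups.
  · linear_combination (φ (0, 0)).re * h00.2 - (φ (0, 0)).im * h00.1 - (φ (1, 1)).re * h11.2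
      + (φ (1, 1)).im * h11.1 + (φ (1, 0)).re * h10.2 - (φ (1, 0)).im * h10.1
      - (φ (0, 1)).re * h01.2 + (φ (0, 1)).im * h01.1
  · linear_combination -(φ (0, 0)).re * h00.1 - (φ (0, 0)).im * h00.2 + (φ (1, 1)).re * h11.1
      + (φ (1, 1)).im * h11.2 + (φ (1, 0)).im * h10.2 + (φ (1, 0)).re * h10.1
      - (φ (0, 1)).im * h01.2 - (φ (0, 1)).re * h01.1
  · linear_combination -(φ (0, 0)).re * h11.2 - (φ (0, 0)).im * h11.1 - (φ (1, 1)).re * h00.2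
      - (φ (1, 1)).im * h00.1 + (φ (0, 1)).re * h10.2 + (φ (0, 1)).im * h10.1
      + (φ (1, 0)).re * h01.2 + (φ (1, 0)).im * h01.1
  · linear_combination -(φ (0, 0)).re * h11.1 + (φ (0, 0)).im * h11.2 - (φ (1, 1)).re * h00.1
      + (φ (1, 1)).im * h00.2 - (φ (0, 1)).im * h10.2 + (φ (0, 1)).re * h10.1
      - (φ (1, 0)).im * h01.2 + (φ (1, 0)).re * h01.1

/-! ### Equivariance under the spin group -/

theorem tensorOp_spinMat_apply (z w : ℂ) (ψ : Spinor) (p : Fin 2 × Fin 2) :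
    tensorOp (spinMat z) (spinMat w) ψ p =
      (if p.1 = 0 then star z else z) * (if p.2 = 0 then star w else w) * ψ p := by
  obtain ⟨a, b⟩ := p
  rw [spinMat_eq, spinMat_eq, tensorOp_apply]
  fin_cases a <;> fin_cases b <;> simp

/-- The factors are conj(zw) on the coordinate (0, 0) and zw on (1, 1); they become one left factor
because J u = conj(u) J. -/
theorem quat_tensorOp_spinMat (z w : ℂ) (ψ : Spinor) :
    quat (tensorOp (spinMat z) (spinMat w) ψ) = (star (z * w) : ℂ) * quat ψ := by
  ext <;> simp [Quaternion.re_mul, Quaternion.imI_mul, Quaternion.imJ_mul, Quaternion.imK_mul,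
    quat_re, quat_imI, quat_imJ, quat_imK, tensorOp_spinMat_apply] <;> ring

/-- The pairing of positive spinors is invariant under the spin group. -/
theorem pairing_tensorOp_spinMat (z w : Circle) (φ ψ : Spinor) :
    pairing (tensorOp (spinMat z) (spinMat w) φ) (tensorOp (spinMat z) (spinMat w) ψ) =
      pairing φ ψ := by
  have h : star ((star ((z : ℂ) * w) : ℂ) : ℍ[ℝ]) * (star ((z : ℂ) * w) : ℂ) = 1 := by
    have h1 := Circle.normSq_coe (z * w)
    rw [Complex.normSq_apply, Circle.coe_mul] at h1
    have h2 : Quaternion.normSq ((star ((z : ℂ) * w) : ℂ) : ℍ[ℝ]) = 1 := by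
      rw [Quaternion.normSq_def']
      refine Eq.trans ?_ h1
      simp
      ring
    rw [Quaternion.star_mul_self, h2, Quaternion.coe_one]
  rw [pairing, pairing, quat_tensorOp_spinMat, quat_tensorOp_spinMat, star_mul, mul_assoc,
    ← mul_assoc (star _) _ (quat φ), h, one_mul]

theorem minusPart_tensorOp_spinMat (z w : ℂ) (ψ : Spinor) :
    minusPart (tensorOp (spinMat z) (spinMat w) ψ) =
      tensorOp (spinMat z) (spinMat w) (minusPart ψ) := by
  ext p
  simp [minusPart_apply, tensorOp_spinMat_apply]

theorem plusPart_tensorOp_spinMat (z w : ℂ) (ψ : Spinor) :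
    plusPart (tensorOp (spinMat z) (spinMat w) ψ) =
      tensorOp (spinMat z) (spinMat w) (plusPart ψ) := by
  ext p
  simp [plusPart_apply, tensorOp_spinMat_apply]

theorem cliffordLeft_tensorOp_spinMat (z w : Circle) (c c' : Fin 2 → ℝ) (ψ : Spinor)
    (h0 : c' 0 = ((z : ℂ) ^ 2).re * c 0 + ((z : ℂ) ^ 2).im * c 1)
    (h1 : c' 1 = -((z : ℂ) ^ 2).im * c 0 + ((z : ℂ) ^ 2).re * c 1) :
    cliffordLeft c (tensorOp (spinMat z) (spinMat w) ψ) =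
      tensorOp (spinMat z) (spinMat w) (cliffordLeft c' ψ) := by
  have hz : star (z : ℂ) * z = 1 := by simp [← Complex.normSq_eq_conj_mul_self]
  -- A vector acts by off-diagonal entries c₀ i ± c₁. Rotating its coordinates multiplies them by z²
  -- or conj(z)², and conj(z) z = 1 reduces this to the diagonal entries of `spinMat z`.
  have h2 : (c' 0 : ℂ) * Complex.I + c' 1 = (z : ℂ) ^ 2 * (c 0 * Complex.I + c 1) := by
    rw [h0, h1]
    apply Complex.ext <;> simp <;> ring
  have h3 : (c' 0 : ℂ) * Complex.I - c' 1 = star (z : ℂ) ^ 2 * (c 0 * Complex.I - c 1) := by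
    rw [h0, h1]
    apply Complex.ext <;> simp [pow_two] <;> ring
  ext ⟨a, b⟩
  simp only [tensorOp_spinMat_apply, cliffordLeft_apply, h2, h3]
  fin_cases a
  · simp only [Fin.zero_eta, if_true, one_ne_zero, if_false]
    linear_combination (-(z : ℂ) * (if b = 0 then 1 else -1) * (c 0 * Complex.I + c 1) *
      (if b = 0 then star (w : ℂ) else w) * ψ (1, b)) * hz
  · simp only [Fin.mk_one, if_true, one_ne_zero, if_false]
    linear_combination (-star (z : ℂ) * (if b = 0 then 1 else -1) * (c 0 * Complex.I - c 1) *
      (if b = 0 then star (w : ℂ) else w) * ψ (0, b)) * hz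

theorem pairingForm_tensorOp_spinMat (z w : Circle) (c c' : Fin 2 → ℝ) (φ ψ : Spinor)
    (h0 : c' 0 = ((z : ℂ) ^ 2).re * c 0 + ((z : ℂ) ^ 2).im * c 1)
    (h1 : c' 1 = -((z : ℂ) ^ 2).im * c 0 + ((z : ℂ) ^ 2).re * c 1) :
    pairingForm c (tensorOp (spinMat z) (spinMat w) φ) (tensorOp (spinMat z) (spinMat w) ψ) =
      pairingForm c' φ ψ := by
  rw [pairingForm, pairingForm, minusPart_tensorOp_spinMat, plusPart_tensorOp_spinMat,
    cliffordLeft_tensorOp_spinMat z w c c' _ h0 h1, pairing_tensorOp_spinMat]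

theorem pairingCLM_apply (c : Fin 2 → ℝ) (φ ψ : Spinor) :
    pairingCLM c φ ψ = pairingForm c φ ψ := rfl

/-! ### Calculus of quadratic expressions -/

section Bilinear

variable {M : Type*} [TopologicalSpace M] [ChartedSpace (EuclideanSpace ℝ (Fin 2)) M]
  {F G : Type*} [NormedAddCommGroup F] [NormedSpace ℝ F] [NormedAddCommGroup G] [NormedSpace ℝ G]

theorem mvfderiv_congr {f g : M → F} {x : M} (h : f =ᶠ[nhds x] g) (v : TangentSpace (𝓡 2) x) :
    mvfderiv (𝓡 2) f x v = mvfderiv (𝓡 2) g x v :=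
  congrArg (fun L : EuclideanSpace ℝ (Fin 2) →L[ℝ] F => L v) h.mfderiv_eq

theorem hasFDerivAt_bilinear_self (B : F →L[ℝ] F →L[ℝ] G) (v : F) :
    HasFDerivAt (fun w => B w w) (B v + B.flip v) v := by
  convert! B.hasFDerivAt_of_bilinear (hasFDerivAt_id v) (hasFDerivAt_id v) using 1

theorem mvfderiv_bilinear_self (B : F →L[ℝ] F →L[ℝ] G) {f : M → F} {x : M}
    (hf : MDifferentiableAt (𝓡 2) 𝓘(ℝ, F) f x) (v : TangentSpace (𝓡 2) x) :
    mvfderiv (𝓡 2) (fun y => B (f y) (f y)) x v =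
      B (mvfderiv (𝓡 2) f x v) (f x) + B (f x) (mvfderiv (𝓡 2) f x v) := by
  have h := (hasFDerivAt_bilinear_self B (f x)).hasMFDerivAt.comp x hf.hasMFDerivAt
  have h' := congrArg (fun L => L v) h.mfderiv
  refine Eq.trans h' ?_
  exact add_comm _ _

theorem contMDiffAt_bilinear_self (B : F →L[ℝ] F →L[ℝ] G) {f : M → F} {x : M}
    (hf : ContMDiffAt (𝓡 2) 𝓘(ℝ, F) ∞ f x) :
    ContMDiffAt (𝓡 2) 𝓘(ℝ, G) ∞ (fun y => B (f y) (f y)) x :=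
  ContMDiffAt.clm_apply (B.contDiff.contMDiff.contMDiffAt.comp x hf) hf

theorem contMDiffAt_smulRight {L : M → F →L[ℝ] ℝ} {f : M → G} {x : M}
    (hL : ContMDiffAt (𝓡 2) 𝓘(ℝ, F →L[ℝ] ℝ) ∞ L x) (hf : ContMDiffAt (𝓡 2) 𝓘(ℝ, G) ∞ f x) :
    ContMDiffAt (𝓡 2) 𝓘(ℝ, F →L[ℝ] G) ∞ (fun y => (L y).smulRight (f y)) x :=
  (isBoundedBilinearMap_smulRight (𝕜 := ℝ)).contDiff.contMDiff.contMDiffAt.comp x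
    (hL.prodMk_space hf)

end Bilinear

/-! ### A spinor field in the frames chosen around a point -/

section Twisted

variable {M : Type*} [TopologicalSpace M] [ChartedSpace (EuclideanSpace ℝ (Fin 2)) M]
  {V : M → Type*} [TopologicalSpace (TotalSpace (EuclideanSpace ℝ (Fin 2)) V)]
  [∀ x, NormedAddCommGroup (V x)] [∀ x, InnerProductSpace ℝ (V x)]
  [FiberBundle (EuclideanSpace ℝ (Fin 2)) V]
  {E : M → Type*} [TopologicalSpace (TotalSpace (EuclideanSpace ℝ (Fin 2)) E)]
  [∀ x, NormedAddCommGroup (E x)] [∀ x, InnerProductSpace ℝ (E x)]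
  [FiberBundle (EuclideanSpace ℝ (Fin 2)) E]
  {oV : BundleOrientation V} {oE : BundleOrientation E}
  {ι κ : Type*} (sV : SpinStructure oV ι) (sE : SpinStructure oE κ)

/-- The coordinates of a spinor field in the pair of frames that is chosen around `x`. -/
def coordinates (φ : SpinorField sV sE) (x y : M) : Spinor :=
  (spinorBundle sV sE).coordChange
      ((spinorBundle sV sE).indexAt y) ((spinorBundle sV sE).indexAt x) y (φ y)

theorem coordinates_self (φ : SpinorField sV sE) (x : M) : coordinates sV sE φ x x = φ x :=
  (spinorBundle sV sE).coordChange_self _ _ ((spinorBundle sV sE).mem_baseSet_at x) _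

theorem contMDiffAt_coordinates (φ : SpinorField sV sE) (x : M) :
    ContMDiffAt (𝓡 2) 𝓘(ℝ, Spinor) ∞ (coordinates sV sE φ x) x :=
  (contMDiffAt_section x).1 (φ.contMDiff x)

theorem pairingForm_coordinates (φ : SpinorField sV sE) {x y : M}
    (hy : y ∈ (spinorBundle sV sE).baseSet ((spinorBundle sV sE).indexAt x)) (X : V y) :
    fiberPairing sV sE y (cliffordFirst sV sE y X (fiberMinus sV sE y (φ y)))
        (fiberPlus sV sE y (φ y)) =
      pairingForm (fun a => inner ℝ (firstFrame sV sE x a y) X)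
        (coordinates sV sE φ x y) (coordinates sV sE φ x y) := by
  have hy' := (spinorBundle sV sE).mem_baseSet_at y
  -- The coordinate change at `y` is the spin action of the lift from the frame chosen at `x` to the
  -- one chosen at `y`; the two goals say that the components of `X` rotate accordingly.
  refine (pairingForm_tensorOp_spinMat _ _ _ _ (φ y) (φ y) ?_ ?_).symm
  · rw [firstFrame, sV.lift_zero _ _ y ⟨hy.1, hy'.1⟩, inner_add_left, inner_smul_left,
      inner_smul_left]
    rfl
  · rw [firstFrame, sV.lift_one _ _ y ⟨hy.1, hy'.1⟩, inner_add_left, inner_smul_left,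
      inner_smul_left]
    rfl

theorem contMDiffAt_firstFrame (x : M) (a : Fin 2) :
    ContMDiffAt (𝓡 2) ((𝓡 2).prod 𝓘(ℝ, EuclideanSpace ℝ (Fin 2))) ∞
      (fun y => TotalSpace.mk' (EuclideanSpace ℝ (Fin 2)) y (firstFrame sV sE x a y)) x :=
  (sV.isFrame _).contMDiffAt (sV.isOpen_dom _) ((spinorBundle sV sE).mem_baseSet_at x).1 a

theorem orthonormal_firstFrame {x y : M}
    (hy : y ∈ (spinorBundle sV sE).baseSet ((spinorBundle sV sE).indexAt x)) :
    Orthonormal ℝ fun a => firstFrame sV sE x a y :=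
  sV.orthonormal _ _ hy.1

theorem baseSet_mem_nhds (x : M) :
    (spinorBundle sV sE).baseSet ((spinorBundle sV sE).indexAt x) ∈ nhds x :=
  ((spinorBundle sV sE).isOpen_baseSet _).mem_nhds ((spinorBundle sV sE).mem_baseSet_at x)

theorem sum_inner_smul_firstFrame (x : M) (X : V x) :
    X = inner ℝ (firstFrame sV sE x 0 x) X • firstFrame sV sE x 0 x +
      inner ℝ (firstFrame sV sE x 1 x) X • firstFrame sV sE x 1 x := by
  have hx := (spinorBundle sV sE).mem_baseSet_at x
  have hf := sV.isFrame ((spinorBundle sV sE).indexAt x).1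
  have ho := orthonormal_firstFrame sV sE hx
  have hs : ⊤ ≤ Submodule.span ℝ (Set.range fun a => firstFrame sV sE x a x) :=
    hf.generating hx.1
  have h := (OrthonormalBasis.mk ho hs).sum_repr' X
  rw [OrthonormalBasis.coe_mk, Fin.sum_univ_two] at h
  exact h.symm

/-- The coefficient `⟨⟨eₐ · φ⁻, φ⁺⟩⟩` in the frame that is chosen around `x`. -/
def xiCoeff (φ : SpinorField sV sE) (x : M) (a : Fin 2) (y : M) : ℍ[ℝ] :=
  pairingCLM (Pi.single a 1) (coordinates sV sE φ x y) (coordinates sV sE φ x y)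

theorem contMDiffAt_xiCoeff (φ : SpinorField sV sE) (x : M) (a : Fin 2) :
    ContMDiffAt (𝓡 2) 𝓘(ℝ, ℍ[ℝ]) ∞ (xiCoeff sV sE φ x a) x :=
  contMDiffAt_bilinear_self _ (contMDiffAt_coordinates sV sE φ x)

end Twisted

/-! ### Local form and smoothness of ξ -/

section Surface

variable {M : Type*} [TopologicalSpace M] [ChartedSpace (EuclideanSpace ℝ (Fin 2)) M]
  [IsManifold (𝓡 2) ∞ M]
  [RiemannianBundle (fun x : M => TangentSpace (𝓡 2) x)]
  {E : M → Type*} [TopologicalSpace (TotalSpace (EuclideanSpace ℝ (Fin 2)) E)]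
  [∀ x, NormedAddCommGroup (E x)] [∀ x, InnerProductSpace ℝ (E x)]
  [FiberBundle (EuclideanSpace ℝ (Fin 2)) E]
  {oM : BundleOrientation fun x : M => TangentSpace (𝓡 2) x} {oE : BundleOrientation E}
  {ι κ : Type*} (sM : SpinStructure oM ι) (sE : SpinStructure oE κ)

theorem xi_eq (φ : SpinorField sM sE) {x y : M}
    (hy : y ∈ (spinorBundle sM sE).baseSet ((spinorBundle sM sE).indexAt x))
    (X : TangentSpace (𝓡 2) y) :
    xi sM sE φ y X =
      inner ℝ (firstFrame sM sE x 0 y) X • xiCoeff sM sE φ x 0 y +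
      inner ℝ (firstFrame sM sE x 1 y) X • xiCoeff sM sE φ x 1 y :=
  (pairingForm_coordinates sM sE φ hy X).trans (pairingForm_eq_add _ _ _)

variable [IsContMDiffRiemannianBundle (𝓡 2) ∞ (EuclideanSpace ℝ (Fin 2))
      (fun x : M => TangentSpace (𝓡 2) x)]

theorem isSmoothOneForm_xi (φ : SpinorField sM sE) : IsSmoothOneForm (xi sM sE φ) := by
  intro x
  obtain ⟨g, hg, hgi⟩ := IsContMDiffRiemannianBundle.exists_contMDiff (IB := 𝓡 2) (n := ∞)
    (F := EuclideanSpace ℝ (Fin 2)) (E := fun x : M => TangentSpace (𝓡 2) x)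
  have hga (a : Fin 2) := ((contMDiffAt_hom_bundle _).1 (ContMDiffAt.clm_bundle_apply
    (E₂ := fun x : M => TangentSpace (𝓡 2) x →L[ℝ] Bundle.Trivial M ℝ x)
    (F₂ := EuclideanSpace ℝ (Fin 2) →L[ℝ] ℝ)
    hg.contMDiffAt (contMDiffAt_firstFrame sM sE x a))).2
  have hs (a : Fin 2) := contMDiffAt_smulRight (hga a) (contMDiffAt_xiCoeff sM sE φ x a)
  refine (contMDiffAt_hom_bundle _).2 ⟨contMDiffAt_id, ((hs 0).add (hs 1)).congr_of_eventuallyEq ?_⟩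
  filter_upwards [baseSet_mem_nhds sM sE x, (trivializationAt (EuclideanSpace ℝ (Fin 2))
    (fun x : M => TangentSpace (𝓡 2) x) x).open_baseSet.mem_nhds (mem_baseSet_trivializationAt
      (EuclideanSpace ℝ (Fin 2)) (fun x : M => TangentSpace (𝓡 2) x) x)] with y hy hy'
  ext1 v
  simp [ContinuousLinearMap.inCoordinates, xi_eq sM sE φ hy, hgi]

end Surface

/-! ### Closedness of ξ -/

section Closed

set_option synthInstance.maxHeartbeats 400000

variable {M : Type*} [TopologicalSpace M] [ChartedSpace (EuclideanSpace ℝ (Fin 2)) M]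
  [IsManifold (𝓡 2) ∞ M]
  [RiemannianBundle (fun x : M => TangentSpace (𝓡 2) x)]
  {E : M → Type*} [TopologicalSpace (TotalSpace (EuclideanSpace ℝ (Fin 2)) E)]
  [∀ x, NormedAddCommGroup (E x)] [∀ x, InnerProductSpace ℝ (E x)]
  [FiberBundle (EuclideanSpace ℝ (Fin 2)) E]
  {oM : BundleOrientation fun x : M => TangentSpace (𝓡 2) x} {oE : BundleOrientation E}
  {ι κ : Type*} (sM : SpinStructure oM ι) (sE : SpinStructure oE κ)
  (covM : CovariantDerivative (𝓡 2) (EuclideanSpace ℝ (Fin 2))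
      (fun x : M => TangentSpace (𝓡 2) x))
  (covE : CovariantDerivative (𝓡 2) (EuclideanSpace ℝ (Fin 2)) E)

/-- The connection form `⟨∇_X e₁, e₂⟩` of the frame that is chosen around `x`. -/
def connectionForm (x : M) (X : TangentSpace (𝓡 2) x) : ℝ :=
  inner ℝ (covM (firstFrame sM sE x 0) x X) (firstFrame sM sE x 1 x)

/-- The coordinates of the spinorial derivative `∇_X φ` in the pair of frames that is chosen
around `x`. -/
def covDeriv (φ : SpinorField sM sE) (x : M) (X : TangentSpace (𝓡 2) x) : Spinor :=
  mvfderiv (𝓡 2) (coordinates sM sE φ x) x X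
  + ((1 / 2 : ℝ) * connectionForm sM sE covM x X) •
      tensorOp (gamma 0 * gamma 1) 1 (coordinates sM sE φ x x)
  + ((1 / 2 : ℝ) * inner ℝ (covE (secondFrame sM sE x 0) x X) (secondFrame sM sE x 1 x)) •
      tensorOp 1 (gamma 0 * gamma 1) (coordinates sM sE φ x x)

theorem spinorConnection_eq_covDeriv (φ : SpinorField sM sE) (x : M) (X : TangentSpace (𝓡 2) x) :
    spinorConnection sM sE covM covE φ x X = covDeriv sM sE covM covE φ x X := by
  rw [covDeriv, coordinates_self]
  rfl

theorem covDeriv_add (φ : SpinorField sM sE) (x : M) (X Y : TangentSpace (𝓡 2) x) :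
    covDeriv sM sE covM covE φ x (X + Y) =
      covDeriv sM sE covM covE φ x X + covDeriv sM sE covM covE φ x Y := by
  simp only [covDeriv, connectionForm, map_add, inner_add_left]
  module

theorem covDeriv_smul (φ : SpinorField sM sE) (x : M) (r : ℝ) (X : TangentSpace (𝓡 2) x) :
    covDeriv sM sE covM covE φ x (r • X) = r • covDeriv sM sE covM covE φ x X := by
  simp only [covDeriv, connectionForm, map_smul, inner_smul_left, conj_trivial]
  module

/-- The derivative `⟨⟨eₐ · ∇_X φ⁻, φ⁺⟩⟩ + ⟨⟨eₐ · φ⁻, ∇_X φ⁺⟩⟩`. -/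
def covDerivCoeff (φ : SpinorField sM sE) (x : M) (a : Fin 2) (X : TangentSpace (𝓡 2) x) :
    ℍ[ℝ] :=
  pairingForm (Pi.single a 1) (covDeriv sM sE covM covE φ x X) (coordinates sM sE φ x x) +
    pairingForm (Pi.single a 1) (coordinates sM sE φ x x) (covDeriv sM sE covM covE φ x X)

theorem covDerivCoeff_eq (φ : SpinorField sM sE) (x : M) (a : Fin 2)
    (X : TangentSpace (𝓡 2) x) :
    covDerivCoeff sM sE covM covE φ x a X =
      (inner ℝ (firstFrame sM sE x 0 x) X : ℝ) •
        covDerivCoeff sM sE covM covE φ x a (firstFrame sM sE x 0 x) +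
      (inner ℝ (firstFrame sM sE x 1 x) X : ℝ) •
        covDerivCoeff sM sE covM covE φ x a (firstFrame sM sE x 1 x) := by
  conv_lhs => rw [sum_inner_smul_firstFrame sM sE x X]
  simp only [covDerivCoeff, covDeriv_add, covDeriv_smul, pairingForm_add_left,
    pairingForm_add_right, pairingForm_smul_left, pairingForm_smul_right]
  module

/-- Leibniz rule for ⟨⟨e_a · φ⁻, φ⁺⟩⟩: the correction is ⟨⟨(∇_X e_a) · φ⁻, φ⁺⟩⟩, with ∇_X e₁ = ω(X)
e₂ and ∇_X e₂ = -ω(X) e₁. It arises from the bivector terms of the spinorial connection, whose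
factor ½ meets the 2 of `pairingForm_gamma_mul`. -/
theorem mvfderiv_xiCoeff (φ : SpinorField sM sE) (x : M) (a : Fin 2)
    (X : TangentSpace (𝓡 2) x) :
    mvfderiv (𝓡 2) (xiCoeff sM sE φ x a) x X =
      covDerivCoeff sM sE covM covE φ x a X -
        connectionForm sM sE covM x X •
          pairingForm ![(Pi.single a 1 : Fin 2 → ℝ) 1, -(Pi.single a 1 : Fin 2 → ℝ) 0]
            (coordinates sM sE φ x x) (coordinates sM sE φ x x) := by
  have h := mvfderiv_bilinear_self (pairingCLM (Pi.single a 1))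
    ((contMDiffAt_coordinates sM sE φ x).mdifferentiableAt (by simp)) X
  refine h.trans ?_
  have h1 := pairingForm_gamma_mul (Pi.single a 1) (coordinates sM sE φ x x)
  have h2 := pairingForm_one_gamma_mul (Pi.single a 1) (coordinates sM sE φ x x)
  simp only [pairingCLM_apply, covDerivCoeff, covDeriv, pairingForm_add_left,
    pairingForm_add_right, pairingForm_smul_left, pairingForm_smul_right]
  linear_combination (norm := module)
    (-(1 / 2 : ℝ) * connectionForm sM sE covM x X) • h1 -
    ((1 / 2 : ℝ) * inner ℝ (covE (secondFrame sM sE x 0) x X) (secondFrame sM sE x 1 x) : ℝ) • h2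

theorem mvfderiv_xiCoeff_zero (φ : SpinorField sM sE) (x : M) (X : TangentSpace (𝓡 2) x) :
    mvfderiv (𝓡 2) (xiCoeff sM sE φ x 0) x X =
      covDerivCoeff sM sE covM covE φ x 0 X +
        connectionForm sM sE covM x X • xiCoeff sM sE φ x 1 x := by
  rw [mvfderiv_xiCoeff sM sE covM covE, xiCoeff, pairingCLM_apply,
    pairingForm_eq_add ![_, _]]
  simp

theorem mvfderiv_xiCoeff_one (φ : SpinorField sM sE) (x : M) (X : TangentSpace (𝓡 2) x) :
    mvfderiv (𝓡 2) (xiCoeff sM sE φ x 1) x X =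
      covDerivCoeff sM sE covM covE φ x 1 X -
        connectionForm sM sE covM x X • xiCoeff sM sE φ x 0 x := by
  rw [mvfderiv_xiCoeff sM sE covM covE, xiCoeff, pairingCLM_apply,
    pairingForm_eq_add ![_, _]]
  simp

theorem covDerivCoeff_comm_of_dirac (H : (x : M) → E x) (φ : SpinorField sM sE) (x : M)
    (hdirac : dirac sM sE covM covE φ x = cliffordSecond sM sE x (H x) (φ x)) :
    covDerivCoeff sM sE covM covE φ x 1 (firstFrame sM sE x 0 x) =
      covDerivCoeff sM sE covM covE φ x 0 (firstFrame sM sE x 1 x) := by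
  have ho := orthonormal_firstFrame sM sE ((spinorBundle sM sE).mem_baseSet_at x)
  -- Orthonormality turns Clifford multiplication by e_b into that of the standard basis vector, as
  -- `pairingForm_dirac` requires.
  have hc (b : Fin 2) : (fun a => inner ℝ (firstFrame sM sE x a x) (firstFrame sM sE x b x)) =
      (Pi.single b 1 : Fin 2 → ℝ) := by
    ext a
    rw [orthonormal_iff_ite.1 ho a b, Pi.single_apply]
  refine pairingForm_dirac (fun a => covDeriv sM sE covM covE φ x (firstFrame sM sE x a x))
    (coordinates sM sE φ x x) (fun a => inner ℝ (secondFrame sM sE x a x) (H x)) ?_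
  rw [dirac, Fin.sum_univ_two, cliffordFirst, cliffordFirst, hc, hc,
    spinorConnection_eq_covDeriv, spinorConnection_eq_covDeriv] at hdirac
  rw [coordinates_self]
  exact hdirac

theorem mdifferentiableAt_firstFrame (x : M) (a : Fin 2) :
    MDifferentiableAt (𝓡 2) ((𝓡 2).prod 𝓘(ℝ, EuclideanSpace ℝ (Fin 2)))
      (fun y => TotalSpace.mk' (EuclideanSpace ℝ (Fin 2)) y (firstFrame sM sE x a y)) x :=
  (contMDiffAt_firstFrame sM sE x a).mdifferentiableAt (by simp)

/-! ### Structure equations of the coframe -/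

variable [IsContMDiffRiemannianBundle (𝓡 2) ∞ (EuclideanSpace ℝ (Fin 2))
      (fun x : M => TangentSpace (𝓡 2) x)]

/-- Metric compatibility applied to ⟨e_a, e_b⟩, which is constant near the point. -/
theorem inner_cov_firstFrame_add (hcov : covM.IsMetricCompatible) (x : M) (a b : Fin 2)
    (X : (x : M) → TangentSpace (𝓡 2) x) :
    (inner ℝ (covM (firstFrame sM sE x a) x (X x)) (firstFrame sM sE x b x) : ℝ) +
      inner ℝ (firstFrame sM sE x a x) (covM (firstFrame sM sE x b) x (X x)) = 0 := by
  have h := hcov.mvfderiv_inner_eq X (mdifferentiableAt_firstFrame sM sE x a)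
    (mdifferentiableAt_firstFrame sM sE x b)
  refine h.symm.trans ?_
  have hconst : (fun y => (inner ℝ (firstFrame sM sE x a y) (firstFrame sM sE x b y) : ℝ))
      =ᶠ[nhds x] fun _ => if a = b then 1 else 0 := by
    filter_upwards [baseSet_mem_nhds sM sE x] with y hy
    exact orthonormal_iff_ite.1 (orthonormal_firstFrame sM sE hy) a b
  rw [mvfderiv_congr hconst, mvfderiv_const, zero_apply]

theorem inner_cov_firstFrame_zero (hcov : covM.IsMetricCompatible) (x : M)
    (X : (x : M) → TangentSpace (𝓡 2) x) (Y : TangentSpace (𝓡 2) x) :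
    (inner ℝ (covM (firstFrame sM sE x 0) x (X x)) Y : ℝ) =
      connectionForm sM sE covM x (X x) * inner ℝ (firstFrame sM sE x 1 x) Y := by
  have h := inner_cov_firstFrame_add sM sE covM hcov x 0 0 X
  rw [real_inner_comm (covM (firstFrame sM sE x 0) x (X x))] at h
  conv_lhs => rw [sum_inner_smul_firstFrame sM sE x Y]
  rw [inner_add_right, inner_smul_right, inner_smul_right, connectionForm]
  -- The relation `h` reads 2 ⟨∇_X e₁, e₁⟩ = 0, whence the factor ½.
  linear_combination (1 / 2 : ℝ) * inner ℝ (firstFrame sM sE x 0 x) Y * h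

theorem inner_cov_firstFrame_one (hcov : covM.IsMetricCompatible) (x : M)
    (X : (x : M) → TangentSpace (𝓡 2) x) (Y : TangentSpace (𝓡 2) x) :
    (inner ℝ (covM (firstFrame sM sE x 1) x (X x)) Y : ℝ) =
      -connectionForm sM sE covM x (X x) * inner ℝ (firstFrame sM sE x 0 x) Y := by
  have h := inner_cov_firstFrame_add sM sE covM hcov x 1 1 X
  have h' := inner_cov_firstFrame_add sM sE covM hcov x 0 1 X
  conv_lhs => rw [sum_inner_smul_firstFrame sM sE x Y]
  rw [inner_add_right, inner_smul_right, inner_smul_right, connectionForm]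
  rw [real_inner_comm (covM (firstFrame sM sE x 1) x (X x))] at h h'
  linear_combination (1 / 2 : ℝ) * inner ℝ (firstFrame sM sE x 1 x) Y * h +
    inner ℝ (firstFrame sM sE x 0 x) Y * h'

/-- `d⟨eₐ, ·⟩(X, Y) = ⟨∇_X eₐ, Y⟩ - ⟨∇_Y eₐ, X⟩` for the Levi-Civita connection. -/
theorem extDeriv_coframe (hcov : IsLeviCivita covM) (x : M) (a : Fin 2)
    {X Y : (x : M) → TangentSpace (𝓡 2) x}
    (hX : MDifferentiableAt (𝓡 2) ((𝓡 2).prod (𝓡 2)) (fun y => (X y : TangentBundle (𝓡 2) M)) x)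
    (hY : MDifferentiableAt (𝓡 2) ((𝓡 2).prod (𝓡 2)) (fun y => (Y y : TangentBundle (𝓡 2) M)) x) :
    mvfderiv (𝓡 2) (fun y => (inner ℝ (firstFrame sM sE x a y) (Y y) : ℝ)) x (X x) -
      mvfderiv (𝓡 2) (fun y => (inner ℝ (firstFrame sM sE x a y) (X y) : ℝ)) x (Y x) -
      inner ℝ (firstFrame sM sE x a x) (VectorField.mlieBracket (𝓡 2) X Y x) =
    inner ℝ (covM (firstFrame sM sE x a) x (X x)) (Y x) -
      inner ℝ (covM (firstFrame sM sE x a) x (Y x)) (X x) := by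
  -- After the Leibniz rule, torsion-freeness makes ⟨e_a, ∇_X Y - ∇_Y X⟩ cancel the bracket term.
  rw [hcov.2.mvfderiv_inner_eq X (mdifferentiableAt_firstFrame sM sE x a) hY,
    hcov.2.mvfderiv_inner_eq Y (mdifferentiableAt_firstFrame sM sE x a) hX,
    ← (CovariantDerivative.torsion_eq_zero_iff covM).1 hcov.1 hX hY, inner_sub_right]
  ring

/-- The derivative of `ξ(Y)` in the direction of `X`. -/
theorem mvfderiv_xi (φ : SpinorField sM sE) (x : M) {Y : (x : M) → TangentSpace (𝓡 2) x}
    (hY : MDifferentiableAt (𝓡 2) ((𝓡 2).prod (𝓡 2)) (fun y => (Y y : TangentBundle (𝓡 2) M)) x)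
    (v : TangentSpace (𝓡 2) x) :
    mvfderiv (𝓡 2) (fun y => xi sM sE φ y (Y y)) x v =
      ∑ a, ((inner ℝ (firstFrame sM sE x a x) (Y x) : ℝ) •
        mvfderiv (𝓡 2) (xiCoeff sM sE φ x a) x v +
        mvfderiv (𝓡 2) (fun y => (inner ℝ (firstFrame sM sE x a y) (Y y) : ℝ)) x v •
          xiCoeff sM sE φ x a x) := by
  have hev : (fun y => xi sM sE φ y (Y y)) =ᶠ[nhds x]
      (fun y => (inner ℝ (firstFrame sM sE x 0 y) (Y y) : ℝ)) • xiCoeff sM sE φ x 0 +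
      (fun y => (inner ℝ (firstFrame sM sE x 1 y) (Y y) : ℝ)) • xiCoeff sM sE φ x 1 := by
    filter_upwards [baseSet_mem_nhds sM sE x] with y hy using xi_eq sM sE φ hy (Y y)
  have hi (a : Fin 2) := (mdifferentiableAt_firstFrame sM sE x a).inner_bundle hY
  have hx (a : Fin 2) := (contMDiffAt_xiCoeff sM sE φ x a).mdifferentiableAt (n := ∞) (by simp)
  rw [mvfderiv_congr hev, mvfderiv_add ((hi 0).smul (hx 0)) ((hi 1).smul (hx 1)),
    mvfderiv_smul (hi 0) (hx 0), mvfderiv_smul (hi 1) (hx 1), Fin.sum_univ_two]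
  rfl

theorem isClosedOneForm_xi (hcov : IsLeviCivita covM) (H : (x : M) → E x) (φ : SpinorField sM sE)
    (hdirac : ∀ x, dirac sM sE covM covE φ x = cliffordSecond sM sE x (H x) (φ x)) :
    IsClosedOneForm (xi sM sE φ) := by
  intro x X Y hX hY
  replace hX := hX.mdifferentiableAt (by simp)
  replace hY := hY.mdifferentiableAt (by simp)
  have h0 := extDeriv_coframe sM sE covM hcov x 0 hX hY
  have h1 := extDeriv_coframe sM sE covM hcov x 1 hX hY
  rw [inner_cov_firstFrame_zero sM sE covM hcov.2,
    inner_cov_firstFrame_zero sM sE covM hcov.2] at h0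
  rw [inner_cov_firstFrame_one sM sE covM hcov.2,
    inner_cov_firstFrame_one sM sE covM hcov.2] at h1
  have hd := covDerivCoeff_comm_of_dirac sM sE covM covE H φ x (hdirac x)
  rw [extDerivOneForm, mvfderiv_xi sM sE φ x hX, mvfderiv_xi sM sE φ x hY,
    xi_eq sM sE φ ((spinorBundle sM sE).mem_baseSet_at x), Fin.sum_univ_two, Fin.sum_univ_two,
    mvfderiv_xiCoeff_zero sM sE covM covE, mvfderiv_xiCoeff_zero sM sE covM covE,
    mvfderiv_xiCoeff_one sM sE covM covE, mvfderiv_xiCoeff_one sM sE covM covE,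
    covDerivCoeff_eq sM sE covM covE φ x 0 (X x), covDerivCoeff_eq sM sE covM covE φ x 0 (Y x),
    covDerivCoeff_eq sM sE covM covE φ x 1 (X x), covDerivCoeff_eq sM sE covM covE φ x 1 (Y x), hd]
  -- By `hd` the C_a part of dξ is already zero; what remains is dθ_a f_a against the ω terms of
  -- df_a, which the structure equations `h0` and `h1` cancel.
  linear_combination (norm := module) h0 • xiCoeff sM sE φ x 0 x + h1 • xiCoeff sM sE φ x 1 x

end Closed

end SpinSurface

end

theorem mainTheorem4
    -- a Riemannian surface `M`
    {M : Type*} [TopologicalSpace M] [ChartedSpace (EuclideanSpace ℝ (Fin 2)) M]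
    [IsManifold (𝓡 2) ∞ M]
    [RiemannianBundle (fun x : M => TangentSpace (𝓡 2) x)]
    [IsContMDiffRiemannianBundle (𝓡 2) ∞ (EuclideanSpace ℝ (Fin 2))
      (fun x : M => TangentSpace (𝓡 2) x)]
    -- a smooth Riemannian vector bundle `E` of rank two over `M`
    {E : M → Type*} [TopologicalSpace (TotalSpace (EuclideanSpace ℝ (Fin 2)) E)]
    [∀ x, NormedAddCommGroup (E x)] [∀ x, InnerProductSpace ℝ (E x)]
    [FiberBundle (EuclideanSpace ℝ (Fin 2)) E] [VectorBundle ℝ (EuclideanSpace ℝ (Fin 2)) E]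
    [ContMDiffVectorBundle ∞ (EuclideanSpace ℝ (Fin 2)) E (𝓡 2)]
    [IsContMDiffRiemannianBundle (𝓡 2) ∞ (EuclideanSpace ℝ (Fin 2)) E]
    -- orientations and spin structures of `M` and `E`
    {oM : SpinSurface.BundleOrientation fun x : M => TangentSpace (𝓡 2) x}
    {oE : SpinSurface.BundleOrientation E}
    {ι κ : Type*} (sM : SpinSurface.SpinStructure oM ι) (sE : SpinSurface.SpinStructure oE κ)
    -- the Levi-Civita connection of `M` and a metric connection of `E`
    (covM : CovariantDerivative (𝓡 2) (EuclideanSpace ℝ (Fin 2))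
      (fun x : M => TangentSpace (𝓡 2) x))
    (hcovM : SpinSurface.IsLeviCivita covM)
    (covE : CovariantDerivative (𝓡 2) (EuclideanSpace ℝ (Fin 2)) E)
    (hcovE : covE.IsMetricCompatible)
    -- a section of `E` and a solution of the Dirac equation
    (H : (x : M) → E x) (φ : SpinSurface.SpinorField sM sE)
    (hdirac : ∀ x, SpinSurface.dirac sM sE covM covE φ x =
      SpinSurface.cliffordSecond sM sE x (H x) (φ x))
    (hplus : ∀ x, SpinSurface.fiberNorm sM sE x (SpinSurface.fiberPlus sM sE x (φ x)) = 1)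
    (hminus : ∀ x, SpinSurface.fiberNorm sM sE x (SpinSurface.fiberMinus sM sE x (φ x)) = 1) :
    SpinSurface.IsSmoothOneForm (SpinSurface.xi sM sE φ) ∧
      SpinSurface.IsClosedOneForm (SpinSurface.xi sM sE φ) :=
  ⟨SpinSurface.isSmoothOneForm_xi sM sE φ,
    SpinSurface.isClosedOneForm_xi sM sE covM covE hcovM H φ hdirac⟩
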